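/- **Andrews–Gordon–Bressoud identities.** Write $(z;q)_n=\prod_{j=0}^{n-1}(1-zq^j)$, $(z;q)_\infty=\prod_{j\ge 0}(1-zq^j)$ and $(z_1,z_2,z_3;q)_\infty=(z_1;q)_\infty(z_2;q)_\infty(z_3;q)_\infty$. Let $d\ge 2$ be an integer, $k=\lfloor d/2\rfloor$, $p=d+2$ and $0\le i\le k$. Then the following identities hold in the ring of formal power series $\mathbb Z[[q]]$, where the sums run over all partitions $\lambda=(\lambda_1\ge\lambda_2\ge\cdots\ge\lambda_k\ge 0)$ with at most $k$ non-zero parts and converge (unconditionally, coefficient by coefficient). If $d$ is odd (the Andrews–Gordon identities), $$\sum_{\lambda}\frac{q^{\lambda_1^2+\cdots+\lambda_k^2+\lambda_{i+1}+\cdots+\lambda_k}}{(q;q)_{\lambda_1-\lambda_2}(q;q)_{\lambda_2-\lambda_3}\cdots(q;q)_{\lambda_{k-1}-\lambda_k}\,(q;q)_{\lambda_k}}=\frac{(q^{i+1},q^{p-i-1},q^{p};q^{p})_\infty}{(q;q)_\infty}.$$ If $d$ is even (Bressoud's identities), $$\sum_{\lambda}\frac{q^{\lambda_1^2+\cdots+\lambda_k^2+\lambda_{i+1}+\cdots+\lambda_k}}{(q;q)_{\lambda_1-\lambda_2}(q;q)_{\lambda_2-\lambda_3}\cdots(q;q)_{\lambda_{k-1}-\lambda_k}\,(q^2;q^2)_{\lambda_k}}=\frac{(q^{i+1},q^{p-i-1},q^{p};q^{p})_\infty}{(q;q)_\infty}.$$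 -/

import Mathlib

open PowerSeries
open scoped PowerSeries.WithPiTopology

noncomputable section

/-- The finite `q`-Pochhammer symbol `(z; q)_n = ∏_{0 ≤ j < n} (1 - z q^j)`. -/
def qPoch {A : Type*} [CommRing A] (z q : A) (n : ℕ) : A :=
  ∏ j ∈ Finset.range n, (1 - z * q ^ j)

/-- The infinite `q`-Pochhammer symbol `(z; q)_∞ = ∏_{j ≥ 0} (1 - z q^j)`. -/
def qPochInf {A : Type*} [CommRing A] [TopologicalSpace A] (z q : A) : A :=
  ∏' j : ℕ, (1 - z * q ^ j)

/-- The set of all partitions `l = (l_1 ≥ l_2 ≥ ⋯ ≥ 0)` with at most `k` non-zero parts, as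
infinite sequences. Indices are shifted by one: `l j` is the part `l_{j+1}`. -/
def partitionsLE (k : ℕ) : Set (ℕ → ℕ) :=
  {l | Antitone l ∧ ∀ j, k ≤ j → l j = 0}

/-- The exponent `l_1^2 + ⋯ + l_k^2 + l_{i+1} + ⋯ + l_k`. -/
def agbExponent (k i : ℕ) (l : ℕ → ℕ) : ℕ :=
  ∑ j ∈ Finset.range k, l j ^ 2 + ∑ j ∈ Finset.Ico i k, l j

/-- The denominator
`(q;q)_{l_1-l_2} (q;q)_{l_2-l_3} ⋯ (q;q)_{l_{k-1}-l_k} (q^f;q^f)_{l_k}` in `ℤ⟦q⟧`, for `k ≥ 1`. -/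
def agbDenominator (f k : ℕ) (l : ℕ → ℕ) : ℤ⟦X⟧ :=
  (∏ j ∈ Finset.range (k - 1), qPoch X X (l j - l (j + 1))) *
    qPoch (X ^ f) (X ^ f) (l (k - 1))

/-- The summand of the sum side; the inverse is the one in the ring `ℤ⟦q⟧`, in which the
denominator is a unit. -/
def agbSummand (f k i : ℕ) (l : ℕ → ℕ) : ℤ⟦X⟧ :=
  X ^ agbExponent k i l * Ring.inverse (agbDenominator f k l)

/-- The product side `(q^{i+1}, q^{p-i-1}, q^p; q^p)_∞ / (q; q)_∞` in `ℤ⟦q⟧`. -/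
def agbProduct (p i : ℕ) : ℤ⟦X⟧ :=
  qPochInf (X ^ (i + 1)) (X ^ p) * qPochInf (X ^ (p - i - 1)) (X ^ p) *
    qPochInf (X ^ p) (X ^ p) * Ring.inverse (qPochInf X X)

/-- The infinite products in question converge. -/
theorem multipliable_qPoch_factors {z q : ℤ⟦X⟧} (hq : constantCoeff q = 0) :
    Multipliable fun j : ℕ ↦ 1 - z * q ^ j := by
  simp_rw [sub_eq_add_neg]
  apply WithPiTopology.multipliable_one_add_of_tendsto_order_atTop_nhds_top
  refine ENat.tendsto_nhds_top_iff_natCast_lt.mpr fun n ↦ Filter.eventually_atTop.mpr ⟨n + 1, ?_⟩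
  intro m hm
  rw [order_neg]
  have hX : (X : ℤ⟦X⟧) ^ m ∣ z * q ^ m :=
    Dvd.dvd.mul_left (pow_dvd_pow_of_dvd (X_dvd_iff.mpr hq) m) z
  refine lt_of_lt_of_le (b := (m : ℕ∞)) (by exact_mod_cast hm) ?_
  exact nat_le_order _ _ fun j hj ↦ X_pow_dvd_iff.mp hX j hj

/-- The infinite products have constant term `1` when `z` has constant term `0`. -/
theorem constantCoeff_qPochInf {z q : ℤ⟦X⟧} (hz : constantCoeff z = 0)
    (hq : constantCoeff q = 0) : constantCoeff (qPochInf z q) = 1 := by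
  have h := (multipliable_qPoch_factors (z := z) hq).map_tprod constantCoeff
    (WithPiTopology.continuous_constantCoeff ℤ)
  rw [qPochInf, h]
  simp [hz]

/-- The infinite product that is inverted is a unit. -/
theorem isUnit_qPochInf_X : IsUnit (qPochInf (X : ℤ⟦X⟧) X) := by
  rw [isUnit_iff_constantCoeff, constantCoeff_qPochInf (by simp) (by simp)]
  exact isUnit_one

/-- The denominators of the sum side are units. -/
theorem isUnit_agbDenominator {f : ℕ} (hf : f ≠ 0) (k : ℕ) (l : ℕ → ℕ) :
    IsUnit (agbDenominator f k l) := by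
  rw [isUnit_iff_constantCoeff]
  simp [agbDenominator, qPoch, map_prod, hf]

end

/-! The proof runs the Bailey chain on bilateral sums `β_n = ∑_j α_j / ((q)_{n-j} (q)_{n+M+j})` with
`M = 0, 1`. By q-Vandermonde, passing from `β` to `∑_s q^{s²+Ms} β_s / (q)_{n-s}` multiplies `α_j`
by `q^{j²+Mj}` (`bailey_step`).

The seed is `β_n = 1/(q^f;q^f)_n`, `α_j = (-1)^j q^{(Aj²+(A-2)j)/2}`, with `A = 3` for `f = 1` and
`A = 2` for `f = 2`. Take `r = k - i` steps with `M = 1`, then switch to `M = 0`, then take `i`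
further steps. The switch leaves `α` unchanged because its exponent `e` satisfies `e(-1-j) = e(j) +
2j + 1` (`sum_baileyKernel_zero_eq_one`). Unfolding the steps gives the multisum over partitions.
The final exponent is `(pj² + (A-2+2r)j)/2` with `p = A + 2k`.

As `n → ∞`, the multisum side tends to the required sum over `(q)_∞`, and the bilateral side to `∑
α_j / (q)_∞²`. The Jacobi triple product evaluates `∑ α_j`. Limits are taken as congruences modulo
powers of `q`. -/

/-- The reciprocal `1 / (q^p; q^p)_n` in `ℤ⟦q⟧`, extended by zero to negative `n`. -/
noncomputable def invQPoch (p : ℕ) (n : ℤ) : ℤ⟦X⟧ :=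
  if 0 ≤ n then Ring.inverse (qPoch (X ^ p) (X ^ p) n.toNat) else 0

theorem invQPoch_of_neg (p : ℕ) {n : ℤ} (hn : n < 0) : invQPoch p n = 0 := by
  simp [invQPoch, hn]

theorem invQPoch_natCast (p n : ℕ) :
    invQPoch p n = Ring.inverse (qPoch (X ^ p) (X ^ p) n) := by
  simp [invQPoch]

@[simp]
theorem invQPoch_zero (p : ℕ) : invQPoch p 0 = 1 := by
  simp [invQPoch, qPoch]

theorem isUnit_qPoch_X_pow {p : ℕ} (hp : p ≠ 0) (n : ℕ) :
    IsUnit (qPoch (X ^ p : ℤ⟦X⟧) (X ^ p) n) := by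
  rw [isUnit_iff_constantCoeff]
  simp [qPoch, map_prod, hp]

theorem qPoch_mul_invQPoch {p : ℕ} (hp : p ≠ 0) (n : ℕ) :
    qPoch (X ^ p) (X ^ p) n * invQPoch p n = 1 := by
  rw [invQPoch_natCast, Ring.mul_inverse_cancel _ (isUnit_qPoch_X_pow hp n)]

theorem qPoch_succ {A : Type*} [CommRing A] (z q : A) (n : ℕ) :
    qPoch z q (n + 1) = qPoch z q n * (1 - z * q ^ n) := by
  rw [qPoch, Finset.prod_range_succ, qPoch]

theorem invQPoch_eq_mul_succ {p : ℕ} (hp : p ≠ 0) (n : ℕ) :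
    invQPoch p n = (1 - X ^ (p * (n + 1))) * invQPoch p (n + 1 : ℕ) := by
  have h1 := qPoch_mul_invQPoch hp n
  have h2 := qPoch_mul_invQPoch hp (n + 1)
  rw [qPoch_succ] at h2
  have h3 : (X : ℤ⟦X⟧) ^ p * (X ^ p) ^ n = X ^ (p * (n + 1)) := by ring
  rw [h3] at h2
  calc invQPoch p n = invQPoch p n * (qPoch (X ^ p) (X ^ p) n * (1 - X ^ (p * (n + 1))) *
        invQPoch p (n + 1 : ℕ)) := by rw [h2, mul_one]
    _ = (qPoch (X ^ p) (X ^ p) n * invQPoch p n) * ((1 - X ^ (p * (n + 1))) *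
        invQPoch p (n + 1 : ℕ)) := by ring
    _ = _ := by rw [h1, one_mul]

theorem invQPoch_sub_one {p : ℕ} (hp : p ≠ 0) (n : ℤ) :
    invQPoch p (n - 1) = (1 - X ^ (p * n.toNat)) * invQPoch p n := by
  rcases lt_trichotomy n 0 with h | rfl | h
  · rw [invQPoch_of_neg p h, invQPoch_of_neg p (by omega), mul_zero]
  · simp [invQPoch_of_neg]
  · obtain ⟨m, rfl⟩ : ∃ m : ℕ, n = (m + 1 : ℕ) := ⟨(n - 1).toNat, by omega⟩
    have := invQPoch_eq_mul_succ hp m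
    rw [show ((m + 1 : ℕ) : ℤ) - 1 = m by push_cast; ring, Int.toNat_natCast]
    exact this

/-! ### q-Vandermonde and the Bailey lemma -/

/-- The `q`-Vandermonde summation. -/
theorem sum_invQPoch_vandermonde (N M : ℕ) :
    ∑ t ∈ Finset.range (N + 1), X ^ (t ^ 2 + M * t) *
      (invQPoch 1 (N - t : ℤ) * invQPoch 1 t * invQPoch 1 (t + M : ℤ)) =
      invQPoch 1 N * invQPoch 1 (N + M : ℤ) := by
  induction N generalizing M with
  | zero => simp
  | succ N ih =>
    -- Split `1 - q^{N+1} = (1 - q^{N+1-t}) + q^{N+1-t}(1 - q^t)`. The second part, after `t ↦ t +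
    -- 1`, is the sum for `N` with `M + 1`.
    have key : (1 - X ^ (N + 1)) * ∑ t ∈ Finset.range (N + 1 + 1), X ^ (t ^ 2 + M * t) *
        (invQPoch 1 ((N + 1 : ℕ) - t : ℤ) * invQPoch 1 t * invQPoch 1 (t + M : ℤ)) =
        ∑ t ∈ Finset.range (N + 1), X ^ (t ^ 2 + M * t) *
          (invQPoch 1 (N - t : ℤ) * invQPoch 1 t * invQPoch 1 (t + M : ℤ)) +
        X ^ (M + N + 1) * ∑ t ∈ Finset.range (N + 1), X ^ (t ^ 2 + (M + 1) * t) *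
          (invQPoch 1 (N - t : ℤ) * invQPoch 1 t * invQPoch 1 (t + (M + 1 : ℕ) : ℤ)) := by
      have h1 : ∀ t ∈ Finset.range (N + 1 + 1), (1 - X ^ (N + 1)) * (X ^ (t ^ 2 + M * t) *
          (invQPoch 1 ((N + 1 : ℕ) - t : ℤ) * invQPoch 1 t * invQPoch 1 (t + M : ℤ))) =
          X ^ (t ^ 2 + M * t) *
            (invQPoch 1 (N - t : ℤ) * invQPoch 1 t * invQPoch 1 (t + M : ℤ)) +
          X ^ (t ^ 2 + M * t + (N + 1 - t)) *
            (invQPoch 1 ((N + 1 : ℕ) - t : ℤ) * invQPoch 1 (t - 1 : ℤ) *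
              invQPoch 1 (t + M : ℤ)) := by
        intro t ht
        have ht' : t ≤ N + 1 := by simpa [Nat.lt_succ_iff] using ht
        have e1 := invQPoch_sub_one one_ne_zero ((N + 1 : ℕ) - t : ℤ)
        have e2 := invQPoch_sub_one one_ne_zero (t : ℤ)
        rw [show (((N + 1 : ℕ) : ℤ) - t).toNat = N + 1 - t by omega,
          show ((N + 1 : ℕ) - t : ℤ) - 1 = N - t by push_cast; ring] at e1
        rw [Int.toNat_natCast] at e2
        rw [e1, e2]
        have e3 : (X : ℤ⟦X⟧) ^ (N + 1) = X ^ (N + 1 - t) * X ^ t := by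
          rw [← pow_add]; congr 1; omega
        rw [e3, pow_add X (t ^ 2 + M * t)]
        ring
      rw [Finset.mul_sum, Finset.sum_congr rfl h1, Finset.sum_add_distrib]
      congr 1
      · rw [Finset.sum_range_succ, invQPoch_of_neg 1 (n := (N : ℤ) - (N + 1 : ℕ)) (by omega)]
        simp
      · rw [Finset.sum_range_succ', invQPoch_of_neg 1 (n := ((0 : ℕ) : ℤ) - 1) (by omega),
          Finset.mul_sum]
        simp only [mul_zero, zero_mul, add_zero]
        refine Finset.sum_congr rfl fun t ht ↦ ?_
        have ht' : t ≤ N := by simpa [Nat.lt_succ_iff] using ht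
        obtain ⟨r, rfl⟩ := Nat.exists_eq_add_of_le ht'
        rw [show t + r + 1 - (t + 1) = r by omega,
          show ((t + r + 1 : ℕ) : ℤ) - (t + 1 : ℕ) = ((t + r : ℕ) : ℤ) - t by push_cast; ring,
          show ((t + 1 : ℕ) : ℤ) - 1 = t by push_cast; ring,
          show ((t + 1 : ℕ) : ℤ) + M = t + (M + 1 : ℕ) by push_cast; ring]
        ring
    rw [ih, ih] at key
    have e1 := invQPoch_eq_mul_succ one_ne_zero N
    have e2 := invQPoch_eq_mul_succ one_ne_zero (N + M)
    rw [one_mul] at e1 e2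
    have hu : IsUnit (1 - X ^ (N + 1) : ℤ⟦X⟧) := by simp [isUnit_iff_constantCoeff]
    apply hu.mul_left_cancel
    rw [key]
    have c1 : ((N : ℤ) + (M : ℤ)) = ((N + M : ℕ) : ℤ) := by push_cast; ring
    have c2 : ((N : ℤ) + ((M + 1 : ℕ) : ℤ)) = ((N + M + 1 : ℕ) : ℤ) := by push_cast; ring
    have c3 : (((N + 1 : ℕ) : ℤ) + (M : ℤ)) = ((N + M + 1 : ℕ) : ℤ) := by push_cast; ring
    rw [c1, c2, c3, e2, e1]
    ring

/-- Terms with `s < r` vanish; substituting `s = r + t` leaves q-Vandermonde with `N = n - r` and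
`M` replaced by `2r + M`. -/
theorem sum_bailey_kernel_natCast (n r M : ℕ) :
    ∑ s ∈ Finset.range (n + 1), X ^ (s ^ 2 + M * s) *
      (invQPoch 1 (n - s : ℤ) * (invQPoch 1 (s - r : ℤ) * invQPoch 1 (s + M + r : ℤ))) =
      X ^ (r ^ 2 + M * r) * (invQPoch 1 (n - r : ℤ) * invQPoch 1 (n + M + r : ℤ)) := by
  rcases lt_or_ge n r with h | h
  · rw [invQPoch_of_neg 1 (n := (n : ℤ) - r) (by omega), zero_mul, mul_zero]
    refine Finset.sum_eq_zero fun s hs ↦ ?_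
    have := Finset.mem_range.mp hs
    rw [invQPoch_of_neg 1 (n := (s : ℤ) - r) (by omega)]
    simp
  · obtain ⟨N, rfl⟩ := Nat.exists_eq_add_of_le h
    rw [add_assoc, Finset.sum_range_add, Finset.sum_eq_zero, zero_add]
    · have := sum_invQPoch_vandermonde N (2 * r + M)
      rw [show ((r + N : ℕ) : ℤ) - r = N by push_cast; ring,
        show ((r + N : ℕ) + M + r : ℤ) = N + (2 * r + M : ℕ) by push_cast; ring, ← this,
        Finset.mul_sum]
      refine Finset.sum_congr rfl fun t _ ↦ ?_
      rw [show ((r + N : ℕ) - (r + t : ℕ) : ℤ) = N - t by push_cast; ring,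
        show ((r + t : ℕ) - r : ℤ) = t by push_cast; ring,
        show ((r + t : ℕ) + M + r : ℤ) = t + (2 * r + M : ℕ) by push_cast; ring]
      ring
    · intro s hs
      have := Finset.mem_range.mp hs
      rw [invQPoch_of_neg 1 (n := (s : ℤ) - r) (by omega)]
      simp

/-- The kernel `1 / ((q^p; q^p)_{n-j} (q^p; q^p)_{n+M+j})`; Bailey pairs relative to `q^M`
(with `p = 1`) are related by it. -/
noncomputable def baileyKernel (p M : ℕ) (n j : ℤ) : ℤ⟦X⟧ :=
  invQPoch p (n - j) * invQPoch p (n + M + j)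

theorem baileyKernel_reflect (p M : ℕ) (n j : ℤ) :
    baileyKernel p M n (-M - j) = baileyKernel p M n j := by
  rw [baileyKernel, baileyKernel, mul_comm]
  congr 2 <;> ring

theorem baileyKernel_eq_zero {p M : ℕ} {n j : ℤ} (h : n < j ∨ j < -n - M) :
    baileyKernel p M n j = 0 := by
  rcases h with h | h
  · rw [baileyKernel, invQPoch_of_neg p (by omega), zero_mul]
  · rw [baileyKernel, invQPoch_of_neg p (n := n + M + j) (by omega), mul_zero]

/-- The summation behind the Bailey lemma relative to `1` and to `q`. -/
theorem sum_mul_baileyKernel {M : ℕ} (hM : M ≤ 1) (n : ℕ) (j : ℤ) :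
    ∑ s ∈ Finset.range (n + 1), X ^ (s ^ 2 + M * s) *
      (invQPoch 1 (n - s : ℤ) * baileyKernel 1 M s j) =
      X ^ (j ^ 2 + M * j).toNat * baileyKernel 1 M n j := by
  have aux (r : ℕ) : (((r : ℤ) ^ 2 + M * r).toNat) = r ^ 2 + M * r := by
    exact_mod_cast Int.toNat_natCast (r ^ 2 + M * r)
  rcases le_or_gt 0 j with h | h
  · lift j to ℕ using h
    rw [aux]
    exact sum_bailey_kernel_natCast n j M
  -- Both the kernel and `j² + Mj` are invariant under `j ↦ -M - j`, which sends negative `j` to `r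
  -- ≥ 0` because `M ≤ 1`.
  · obtain ⟨r, rfl⟩ : ∃ r : ℕ, j = -M - r := ⟨(-M - j).toNat, by omega⟩
    simp_rw [baileyKernel_reflect]
    rw [show (-(M : ℤ) - r) ^ 2 + M * (-M - r) = r ^ 2 + M * r by ring, aux]
    exact sum_bailey_kernel_natCast n r M

/-- One step of the Bailey chain. -/
theorem bailey_step {M : ℕ} (hM : M ≤ 1) (J : Finset ℤ) (a : ℤ → ℤ⟦X⟧) (n : ℕ) :
    ∑ s ∈ Finset.range (n + 1), X ^ (s ^ 2 + M * s) * (invQPoch 1 (n - s : ℤ) *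
      ∑ j ∈ J, a j * baileyKernel 1 M s j) =
      ∑ j ∈ J, a j * X ^ (j ^ 2 + M * j).toNat * baileyKernel 1 M n j := by
  simp_rw [Finset.mul_sum]
  rw [Finset.sum_comm]
  refine Finset.sum_congr rfl fun j _ ↦ ?_
  rw [mul_assoc, ← sum_mul_baileyKernel hM n j, Finset.mul_sum]
  exact Finset.sum_congr rfl fun s _ ↦ by ring

/-- The sign-power sequence `(-1)^j q^{e j}`. -/
noncomputable def altPow (e : ℤ → ℕ) (j : ℤ) : ℤ⟦X⟧ :=
  (j.negOnePow : ℤ) • X ^ e j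

theorem altPow_mul_X_pow (e : ℤ → ℕ) (j : ℤ) (m : ℕ) :
    altPow e j * X ^ m = altPow (fun j ↦ e j + m) j := by
  simp [altPow, pow_add, mul_assoc]

theorem X_pow_dvd_altPow {e : ℤ → ℕ} {j : ℤ} {m : ℕ} (h : m ≤ e j) : X ^ m ∣ altPow e j :=
  Dvd.dvd.trans (pow_dvd_pow X h) ⟨((j.negOnePow : ℤ) : ℤ⟦X⟧), by simp [altPow, mul_comm]⟩

/-- A sequence with the symmetry below has the same Bailey transform relative to `1` and `q`. -/
theorem sum_baileyKernel_zero_eq_one {e : ℤ → ℕ}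
    (he : ∀ j, (e (-1 - j) : ℤ) = e j + 2 * j + 1) (N : ℤ) (n : ℕ) :
    ∑ j ∈ Finset.Icc (-1 - N) N, altPow e j * baileyKernel 1 0 n j =
      ∑ j ∈ Finset.Icc (-1 - N) N, altPow e j * baileyKernel 1 1 n j := by
  set D : ℤ → ℤ⟦X⟧ := fun j ↦ altPow e j * X ^ (n + 1 + j).toNat * baileyKernel 1 1 n j with hD
  -- Since `1/(q)_{n+j} = (1 - q^{n+1+j})/(q)_{n+1+j}`, the two transforms differ by `∑ D j`. This
  -- vanishes: `D` is odd under `j ↦ -1 - j`, which preserves the summation range.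
  have h0 (j : ℤ) : altPow e j * baileyKernel 1 0 n j =
      altPow e j * baileyKernel 1 1 n j - D j := by
    have := invQPoch_sub_one one_ne_zero (n + 1 + j : ℤ)
    rw [one_mul] at this
    simp only [hD, baileyKernel, Nat.cast_zero, Nat.cast_one, add_zero]
    rw [show (n + j : ℤ) = n + 1 + j - 1 by ring, this]
    ring
  have h1 : ∑ j ∈ Finset.Icc (-1 - N) N, D j = 0 := by
    have hanti (j : ℤ) : D (-1 - j) = -D j := by
      simp only [hD]
      have := baileyKernel_reflect 1 1 n j
      rw [Nat.cast_one] at this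
      rw [this]
      by_cases hj : n < j ∨ j < -n - (1 : ℕ)
      · rw [baileyKernel_eq_zero hj]; simp
      · push Not at hj
        rw [altPow_mul_X_pow, altPow_mul_X_pow, altPow, altPow]
        have h2 := he j
        rw [show e (-1 - j) + (n + 1 + (-1 - j)).toNat = e j + (n + 1 + j).toNat by omega,
          Int.negOnePow_sub, Int.negOnePow_neg]
        simp
    have h2 : ∑ j ∈ Finset.Icc (-1 - N) N, D j = ∑ j ∈ Finset.Icc (-1 - N) N, D (-1 - j) :=
      Finset.sum_nbij' (fun j ↦ -1 - j) (fun j ↦ -1 - j)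
        (by intro j hj; simp only [Finset.mem_Icc] at hj ⊢; omega)
        (by intro j hj; simp only [Finset.mem_Icc] at hj ⊢; omega)
        (by intros; ring) (by intros; ring) (by intro j _; congr 1; ring)
    simp_rw [hanti, Finset.sum_neg_distrib] at h2
    ext m
    have h3 := congrArg (coeff m) h2
    rw [map_neg] at h3
    rw [map_zero]
    omega
  simp_rw [h0, Finset.sum_sub_distrib, h1, sub_zero]

/-! ### Limits as congruences modulo powers of `q` -/

section Limits

open Filter Topology

theorem X_pow_dvd_sub_of_tendsto {ι : Type*} {l : Filter ι} [l.NeBot] {g : ι → ℤ⟦X⟧}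
    {a b : ℤ⟦X⟧} {m : ℕ} (hg : Tendsto g l (𝓝 a)) (h : ∀ᶠ i in l, X ^ m ∣ g i - b) :
    X ^ m ∣ a - b := by
  refine X_pow_dvd_iff.mpr fun d hd ↦ ?_
  have h1 : Tendsto (fun i ↦ coeff d (g i)) l (𝓝 (coeff d a)) :=
    ((WithPiTopology.continuous_coeff ℤ d).tendsto a).comp hg
  have h2 : Tendsto (fun i ↦ coeff d (g i)) l (𝓝 (coeff d b)) := by
    refine tendsto_const_nhds.congr' (h.mono fun i hi ↦ ?_)
    have := X_pow_dvd_iff.mp hi d hd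
    rw [map_sub, sub_eq_zero] at this
    exact this.symm
  rw [map_sub, tendsto_nhds_unique h1 h2, sub_self]

theorem X_pow_dvd_of_hasSum {ι : Type*} {f : ι → ℤ⟦X⟧} {a : ℤ⟦X⟧} {m : ℕ} (hf : HasSum f a)
    (h : ∀ i, X ^ m ∣ f i) : X ^ m ∣ a := by
  have h1 := X_pow_dvd_sub_of_tendsto (b := 0) (m := m) hf
    (Eventually.of_forall fun s ↦ by rw [sub_zero]; exact Finset.dvd_sum fun i _ ↦ h i)
  rwa [sub_zero] at h1

theorem eq_of_forall_X_pow_dvd_sub {a b : ℤ⟦X⟧} (h : ∀ m : ℕ, X ^ (m + 1) ∣ a - b) : a = b := by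
  ext d
  have := X_pow_dvd_iff.mp (h d) d (Nat.lt_succ_self d)
  rwa [map_sub, sub_eq_zero] at this

theorem summable_of_X_pow_dvd {ι : Type*} {f : ι → ℤ⟦X⟧} (w : ι → ℕ)
    (hw : ∀ n, {i | w i ≤ n}.Finite) (h : ∀ i, X ^ w i ∣ f i) : Summable f := by
  rw [WithPiTopology.summable_iff_summable_coeff]
  refine fun d ↦ summable_of_hasFiniteSupport ((hw d).subset fun i hi ↦ ?_)
  by_contra hlt
  simp only [Set.mem_ofPred_eq, not_le] at hlt
  exact hi (X_pow_dvd_iff.mp (h i) d hlt)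

theorem X_pow_dvd_qPochInf_sub {a p m n : ℕ} (hp : p ≠ 0) (hm : m ≤ a + p * n) :
    (X : ℤ⟦X⟧) ^ m ∣ qPochInf (X ^ a) (X ^ p) - qPoch (X ^ a) (X ^ p) n := by
  have h := (multipliable_qPoch_factors (z := X ^ a) (q := X ^ p) (by simp [hp])).hasProd
  refine X_pow_dvd_sub_of_tendsto h.tendsto_prod_nat (eventually_atTop.mpr ⟨n, fun N hN ↦ ?_⟩)
  induction N, hN using Nat.le_induction with
  | base => simp [qPoch]
  | succ N hN ih =>
    rw [Finset.prod_range_succ, mul_sub, mul_one, sub_right_comm]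
    refine dvd_sub ih (Dvd.dvd.mul_left ?_ _)
    rw [← pow_mul, ← pow_add]
    exact pow_dvd_pow X (hm.trans (by gcongr))

end Limits

/-- Congruence modulo `X ^ m` as ring congruence, for multiplicativity. -/
theorem X_pow_dvd_mul_sub_mul {m : ℕ} {a b c d : ℤ⟦X⟧} (h1 : X ^ m ∣ a - b) (h2 : X ^ m ∣ c - d) :
    X ^ m ∣ a * c - b * d := by
  rw [show a * c - b * d = (a - b) * c + b * (c - d) by ring]
  exact dvd_add (h1.mul_right _) (h2.mul_left _)

theorem X_pow_dvd_qPochInf_mul_invQPoch_sub_one {p : ℕ} (hp : p ≠ 0) (n : ℕ) :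
    X ^ (n + 1) ∣ qPochInf (X ^ p) (X ^ p) * invQPoch p n - 1 := by
  rw [← qPoch_mul_invQPoch hp n, ← sub_mul]
  refine Dvd.dvd.mul_right (X_pow_dvd_qPochInf_sub hp ?_) _
  have := Nat.le_mul_of_pos_left n (Nat.pos_of_ne_zero hp)
  omega

theorem hasSum_mul_baileyKernel (p M : ℕ) (n N : ℤ) (hn : n ≤ N) (hM : M ≤ 1) (f : ℤ → ℤ⟦X⟧) :
    HasSum (fun j ↦ f j * baileyKernel p M n j)
      (∑ j ∈ Finset.Icc (-1 - N) N, f j * baileyKernel p M n j) := by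
  refine hasSum_sum_of_ne_finset_zero fun j hj ↦ ?_
  rw [Finset.mem_Icc] at hj
  rw [baileyKernel_eq_zero (by omega), mul_zero]

theorem finite_natAbs_le (n : ℕ) : {j : ℤ | j.natAbs ≤ n}.Finite :=
  (Finset.Icc (-n : ℤ) n).finite_toSet.subset fun j hj ↦ by
    simp only [Set.mem_ofPred_eq] at hj
    simp only [Finset.coe_Icc, Set.mem_Icc]
    omega

/-- The limit `n → ∞` of a Bailey transform, modulo `X ^ (n + 1)`. -/
theorem X_pow_dvd_bailey_sub_tsum {p : ℕ} (hp : p ≠ 0) {f : ℤ → ℤ⟦X⟧}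
    (hf : ∀ j, X ^ j.natAbs ∣ f j) (n : ℕ) :
    X ^ (n + 1) ∣ qPochInf (X ^ p) (X ^ p) ^ 2 *
      (∑ j ∈ Finset.Icc (-1 - n : ℤ) n, f j * baileyKernel p 0 n j) - ∑' j, f j := by
  have h1 := (summable_of_X_pow_dvd _ finite_natAbs_le hf).hasSum
  have h2 := hasSum_mul_baileyKernel p 0 n n le_rfl (by omega) f
  refine X_pow_dvd_of_hasSum ((h2.mul_left (qPochInf (X ^ p) (X ^ p) ^ 2)).sub h1) fun j ↦ ?_
  by_cases hj : j.natAbs ≤ n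
  -- The ratios `(q^p;q^p)_∞ / (q^p;q^p)_{n±j}` are `1` only modulo `q^{n-|j|+1}`; the missing
  -- `q^{|j|}` comes from `f j`.
  · have h3 (r : ℤ) (hr : n - j.natAbs ≤ r) :
        X ^ (n - j.natAbs + 1) ∣ qPochInf (X ^ p) (X ^ p) * invQPoch p r - 1 := by
      lift r to ℕ using by omega
      exact (pow_dvd_pow X (by omega)).trans (X_pow_dvd_qPochInf_mul_invQPoch_sub_one hp r)
    have h4 := X_pow_dvd_mul_sub_mul (h3 (n - j) (by omega)) (h3 (n + (0 : ℕ) + j) (by omega))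
    have h5 := mul_dvd_mul (hf j) h4
    rw [← pow_add, show j.natAbs + (n - j.natAbs + 1) = n + 1 by omega] at h5
    convert h5 using 1
    rw [baileyKernel]
    ring
  · have h3 : X ^ (n + 1) ∣ f j := (pow_dvd_pow X (by omega)).trans (hf j)
    exact dvd_sub ((h3.mul_right _).mul_left _) h3

/-! ### The Jacobi triple product -/

/-- The two-variable partial sums of the finite Jacobi triple product: the inductive step. -/
theorem hasSum_finite_tripleProduct_succ {p a b m n : ℕ} (hp : p ≠ 0)
    {e : ℤ → ℕ} (he : ∀ j, (e (j + 1) : ℤ) = e j + p * j + a)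
    (h : HasSum (fun j ↦ altPow e j * (invQPoch p (m - j : ℤ) * invQPoch p (n + j : ℤ)))
      (qPoch (X ^ a) (X ^ p) m * qPoch (X ^ b) (X ^ p) n * invQPoch p (m + n : ℕ))) :
    HasSum (fun j ↦ altPow e j * (invQPoch p ((m + 1 : ℕ) - j : ℤ) * invQPoch p (n + j : ℤ)))
      (qPoch (X ^ a) (X ^ p) (m + 1) * qPoch (X ^ b) (X ^ p) n *
        invQPoch p (m + 1 + n : ℕ)) := by
  have hu : IsUnit (1 - X ^ (p * (m + n + 1)) : ℤ⟦X⟧) := by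
    simp [isUnit_iff_constantCoeff, hp]
  obtain ⟨v, hv⟩ := hu.exists_left_inv
  -- With `F_m(j)` the summand, `(1 - q^{p(m+n+1)}) F_{m+1}(j) = F_m(j) - q^{a+pm} F_m(j-1)`; `v`
  -- inverts the left factor.
  have h1 := ((Equiv.subRight (1 : ℤ)).hasSum_iff.mpr h).mul_left (X ^ (a + p * m))
  have h2 := (h.sub h1).mul_left v
  convert h2 using 1
  · rfl
  · funext j
    have e1 := invQPoch_sub_one hp (m + 1 - j : ℤ)
    have e2 := invQPoch_sub_one hp (n + j : ℤ)
    simp only [Function.comp_apply, Equiv.subRight_apply]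
    rw [show (m - (j - 1) : ℤ) = m + 1 - j by ring, show (n + (j - 1) : ℤ) = n + j - 1 by ring,
      show (m - j : ℤ) = m + 1 - j - 1 by ring, e1, e2, Nat.cast_succ]
    by_cases hj : (m + 1 - j : ℤ) < 0 ∨ (n + j : ℤ) < 0
    · rcases hj with hj | hj <;> simp [invQPoch_of_neg p hj]
    · push Not at hj
      have h3 : X ^ (a + p * m) * altPow e (j - 1) =
          - altPow e j * X ^ (p * (m + 1 - j).toNat) := by
        rw [mul_comm, neg_mul, altPow_mul_X_pow, altPow_mul_X_pow, altPow, altPow,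
          Int.negOnePow_sub]
        have h4 : e (j - 1) + (a + p * m) = e j + p * (m + 1 - j).toNat := by
          zify
          rw [Int.toNat_of_nonneg hj.1]
          have := he (j - 1)
          rw [sub_add_cancel] at this
          rw [this]
          ring
        rw [h4]
        simp
      have h5 : (X : ℤ⟦X⟧) ^ (p * (m + 1 - j).toNat) * X ^ (p * (n + j).toNat) =
          X ^ (p * (m + n + 1)) := by
        rw [← pow_add, ← mul_add]
        congr 2
        omega
      linear_combination (v * (altPow e j * (invQPoch p (m + 1 - j : ℤ) * invQPoch p (n + j : ℤ)))) * h5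
        - (altPow e j * (invQPoch p (m + 1 - j : ℤ) * invQPoch p (n + j : ℤ))) * hv
        + v * (invQPoch p (m + 1 - j : ℤ) * (1 - X ^ (p * (n + j).toNat)) * invQPoch p (n + j : ℤ)) * h3
  · have e1 := invQPoch_eq_mul_succ hp (m + n)
    rw [e1, qPoch_succ, show m + 1 + n = m + n + 1 by ring,
      show (X : ℤ⟦X⟧) ^ a * (X ^ p) ^ m = X ^ (a + p * m) by ring]
    linear_combination -(qPoch (X ^ a) (X ^ p) m * (1 - X ^ (a + p * m)) *
      qPoch (X ^ b) (X ^ p) n * invQPoch p (m + n + 1 : ℕ)) * hv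

/-- The finite Jacobi triple product. -/
theorem hasSum_finite_tripleProduct {p a b : ℕ} (hp : p ≠ 0) (hab : a + b = p)
    {e : ℤ → ℕ} (h0 : e 0 = 0) (he : ∀ j, (e (j + 1) : ℤ) = e j + p * j + a) (m n : ℕ) :
    HasSum (fun j ↦ altPow e j * (invQPoch p (m - j : ℤ) * invQPoch p (n + j : ℤ)))
      (qPoch (X ^ a) (X ^ p) m * qPoch (X ^ b) (X ^ p) n * invQPoch p (m + n : ℕ)) := by
  have base (a b : ℕ) (hab : a + b = p) (e : ℤ → ℕ) (h0 : e 0 = 0)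
      (he : ∀ j, (e (j + 1) : ℤ) = e j + p * j + a) (m : ℕ) :
      HasSum (fun j ↦ altPow e j * (invQPoch p (m - j : ℤ) * invQPoch p ((0 : ℕ) + j : ℤ)))
        (qPoch (X ^ a) (X ^ p) m * qPoch (X ^ b) (X ^ p) 0 * invQPoch p (m + 0 : ℕ)) := by
    induction m with
    | zero =>
      convert hasSum_single (0 : ℤ) fun j hj ↦ ?_ using 1
      · simp [altPow, h0, qPoch]
      · rcases lt_or_gt_of_ne hj with h | h
        · rw [invQPoch_of_neg p (n := ((0 : ℕ) : ℤ) + j) (by omega)]; simp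
        · rw [invQPoch_of_neg p (n := ((0 : ℕ) : ℤ) - j) (by omega)]; simp
    | succ m ih => exact hasSum_finite_tripleProduct_succ hp he ih
  induction m with
  | zero =>
    -- The reflection `j ↦ -j` exchanges `a` with `b` and `m` with `n`.
    have := base b a (by omega) (fun j ↦ e (-j)) (by simpa using h0) (fun j ↦ by
      have := he (-(j + 1))
      rw [show -(j + 1) + 1 = -j by ring] at this
      rw [this, ← hab]
      push_cast
      ring) n
    convert (Equiv.neg ℤ).hasSum_iff.mpr this using 1
    · funext j
      simp only [Function.comp_apply, Equiv.neg_apply, altPow, neg_neg, Int.negOnePow_neg]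
      rw [sub_neg_eq_add, mul_comm (invQPoch p _), ← sub_eq_add_neg]
    · rw [zero_add, add_zero]
      ring
  | succ m ih => exact hasSum_finite_tripleProduct_succ hp he ih

/-- The Jacobi triple product identity in `ℤ⟦q⟧`. -/
theorem tsum_altPow_eq_qPochInf {p a b : ℕ} (hab : a + b = p) (ha : a ≠ 0) (hb : b ≠ 0)
    {e : ℤ → ℕ} (h0 : e 0 = 0) (he : ∀ j, (e (j + 1) : ℤ) = e j + p * j + a)
    (hle : ∀ j, j.natAbs ≤ e j) :
    ∑' j, altPow e j =
      qPochInf (X ^ a) (X ^ p) * qPochInf (X ^ b) (X ^ p) * qPochInf (X ^ p) (X ^ p) := by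
  have hp : p ≠ 0 := by omega
  have hmod (n : ℕ) : X ^ (n + 1) ∣ qPochInf (X ^ a) (X ^ p) * qPochInf (X ^ b) (X ^ p) *
      qPochInf (X ^ p) (X ^ p) - ∑' j, altPow e j := by
    have h1 := X_pow_dvd_bailey_sub_tsum hp (fun j ↦ X_pow_dvd_altPow (hle j)) n
    have h2 := hasSum_mul_baileyKernel p 0 n n le_rfl (by omega) (altPow e)
    have h3 := hasSum_finite_tripleProduct hp hab h0 he n n
    simp only [baileyKernel, Nat.cast_zero, add_zero] at h1 h2
    rw [h2.unique h3] at h1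
    have hn := Nat.le_mul_of_pos_left n (Nat.pos_of_ne_zero hp)
    have h4 := X_pow_dvd_qPochInf_sub (m := n + 1) (a := a) (n := n) hp (by omega)
    have h5 := X_pow_dvd_qPochInf_sub (m := n + 1) (a := b) (n := n) hp (by omega)
    have h6 := (pow_dvd_pow X (by omega : n + 1 ≤ n + n + 1)).trans
      (X_pow_dvd_qPochInf_mul_invQPoch_sub_one hp (n + n))
    have h7 := X_pow_dvd_mul_sub_mul h4 h5
    convert dvd_add (dvd_sub h1 (h6.mul_left (qPochInf (X ^ p) (X ^ p) *
      (qPoch (X ^ a) (X ^ p) n * qPoch (X ^ b) (X ^ p) n))))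
      (h7.mul_left (qPochInf (X ^ p) (X ^ p))) using 1
    push_cast
    ring
  exact (eq_of_forall_X_pow_dvd_sub hmod).symm

/-! ### Quadratic exponents and the iterated chain -/

/-- The exponent `(A j^2 + B j) / 2`. -/
def quadExp (A B j : ℤ) : ℕ := ((A * j ^ 2 + B * j) / 2).toNat

theorem natAbs_mul_le_quadratic {A B : ℤ} {c : ℤ} (h : |B| ≤ A - c) (hc : 0 ≤ c) (j : ℤ) :
    c * j.natAbs ≤ A * j ^ 2 + B * j := by
  have h1 : |j| ≤ j ^ 2 := by
    rw [← sq_abs]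
    rcases (abs_nonneg j).eq_or_lt with h | h
    · rw [← h]; simp
    · nlinarith
  have h2 : -(B * j) ≤ |B| * |j| := by rw [← abs_mul]; exact neg_le_abs _
  have h3 : |B| * |j| ≤ (A - c) * |j| := mul_le_mul_of_nonneg_right h (abs_nonneg j)
  have h4 : A * |j| ≤ A * j ^ 2 := mul_le_mul_of_nonneg_left h1 (by linarith [abs_nonneg B])
  rw [Int.natCast_natAbs]
  linarith

theorem two_mul_quadExp {A B : ℤ} (h : |B| ≤ A) (hpar : Even (A + B)) (j : ℤ) :
    2 * (quadExp A B j : ℤ) = A * j ^ 2 + B * j := by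
  have h1 : 0 ≤ A * j ^ 2 + B * j := by
    simpa using natAbs_mul_le_quadratic (c := 0) (by simpa using h) le_rfl j
  have h2 : Even (A * j ^ 2 + B * j) := by
    rw [show A * j ^ 2 + B * j = A * (j * (j - 1)) + (A + B) * j by ring]
    exact ((Int.even_mul_pred_self j).mul_left A).add (hpar.mul_right j)
  rw [quadExp, Int.toNat_of_nonneg (Int.ediv_nonneg h1 (by norm_num)),
    Int.two_mul_ediv_two_of_even h2]

theorem altPow_quadExp_mul {A B : ℤ} {M : ℕ} (hM : M ≤ 1) (h : |B| ≤ A) (hpar : Even (A + B))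
    (j : ℤ) :
    altPow (quadExp A B) j * X ^ (j ^ 2 + M * j).toNat =
      altPow (quadExp (A + 2) (B + 2 * M)) j := by
  rw [altPow_mul_X_pow, altPow, altPow]
  congr 2
  have hM' : (M : ℤ) ≤ 1 := by exact_mod_cast hM
  have hM0 : (0 : ℤ) ≤ M := by positivity
  have h1 := two_mul_quadExp h hpar j
  have h2 := two_mul_quadExp (A := A + 2) (B := B + 2 * M)
    (by rw [abs_le] at h ⊢; constructor <;> linarith)
    (by rw [show A + 2 + (B + 2 * M) = A + B + 2 * (1 + M) by ring]
        exact hpar.add (even_two_mul _)) j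
  have h3 : 0 ≤ j ^ 2 + M * j := by
    simpa using natAbs_mul_le_quadratic (A := 1) (B := M) (c := 0)
      (by rw [abs_of_nonneg hM0]; linarith) le_rfl j
  zify
  rw [Int.toNat_of_nonneg h3]
  linarith

/-- The multisum with weights `q^{s^2}` (first `i` steps) and `q^{s^2+s}` (remaining steps),
ending in `β`. -/
noncomputable def nestedSum (β : ℕ → ℤ⟦X⟧) : ℕ → ℕ → ℕ → ℤ⟦X⟧
  | 0, _, n => β n
  | k + 1, i, n => ∑ s ∈ Finset.range (n + 1), X ^ (s ^ 2 + if i = 0 then s else 0) *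
      (invQPoch 1 (n - s : ℤ) * nestedSum β k (i - 1) s)

/-- Each `M = 1` step raises both coefficients of the exponent by `2`, so their difference stays
`2`, which is what the later switch to `M = 0` needs. The range `[-1-N, N]` is fixed so that one
sequence serves every `s ≤ n ≤ N`. -/
theorem nestedSum_zero_eq {β : ℕ → ℤ⟦X⟧} {A : ℤ} (hA : 1 ≤ A) {N : ℕ}
    (hβ : ∀ n ≤ N, β n = ∑ j ∈ Finset.Icc (-1 - N : ℤ) N,
      altPow (quadExp A (A - 2)) j * baileyKernel 1 1 n j) (k : ℕ) :
    ∀ n ≤ N, nestedSum β k 0 n = ∑ j ∈ Finset.Icc (-1 - N : ℤ) N,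
      altPow (quadExp (A + 2 * k) (A - 2 + 2 * k)) j * baileyKernel 1 1 n j := by
  induction k with
  | zero => simpa [nestedSum] using hβ
  | succ k ih =>
    intro n hn
    have h1 := bailey_step le_rfl (Finset.Icc (-1 - N : ℤ) N)
      (altPow (quadExp (A + 2 * k) (A - 2 + 2 * k))) n
    rw [nestedSum]
    convert h1 using 1
    · refine Finset.sum_congr rfl fun s hs ↦ ?_
      rw [ih s (by have := Finset.mem_range.mp hs; omega), if_pos rfl, one_mul]
    · refine Finset.sum_congr rfl fun j _ ↦ ?_
      rw [altPow_quadExp_mul le_rfl (by rw [abs_le]; constructor <;> linarith)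
        ⟨A - 1 + 2 * k, by ring⟩]
      push_cast
      ring_nf

/-- The switch from `M = 1` to `M = 0` is the base case `i = 0`; each further step raises only the
quadratic coefficient. -/
theorem nestedSum_eq {β : ℕ → ℤ⟦X⟧} {A : ℤ} (hA : 1 ≤ A) {N : ℕ}
    (hβ : ∀ n ≤ N, β n = ∑ j ∈ Finset.Icc (-1 - N : ℤ) N,
      altPow (quadExp A (A - 2)) j * baileyKernel 1 1 n j) (r i : ℕ) :
    ∀ n ≤ N, nestedSum β (r + i) i n = ∑ j ∈ Finset.Icc (-1 - N : ℤ) N,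
      altPow (quadExp (A + 2 * (r + i)) (A - 2 + 2 * r)) j * baileyKernel 1 0 n j := by
  induction i with
  | zero =>
    intro n hn
    rw [add_zero, sum_baileyKernel_zero_eq_one, nestedSum_zero_eq hA hβ r n hn]
    · simp
    · intro j
      have h1 := two_mul_quadExp (A := A + 2 * (r + (0 : ℕ))) (B := A - 2 + 2 * r)
        (by rw [abs_le]; push_cast; constructor <;> linarith) ⟨A - 1 + 2 * r, by push_cast; ring⟩
      have h2 := h1 j
      have h3 := h1 (-1 - j)
      push_cast at h2 h3 ⊢
      linarith
  | succ i ih =>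
    intro n hn
    have h1 := bailey_step (Nat.zero_le 1) (Finset.Icc (-1 - N : ℤ) N)
      (altPow (quadExp (A + 2 * (r + i)) (A - 2 + 2 * r))) n
    rw [← add_assoc, nestedSum]
    convert h1 using 1
    · refine Finset.sum_congr rfl fun s hs ↦ ?_
      rw [Nat.add_sub_cancel, ih s (by have := Finset.mem_range.mp hs; omega),
        if_neg (Nat.succ_ne_zero i), zero_mul]
    · refine Finset.sum_congr rfl fun j _ ↦ ?_
      rw [altPow_quadExp_mul (Nat.zero_le 1) (by rw [abs_le]; constructor <;> linarith)
        ⟨A - 1 + 2 * r + i, by ring⟩]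
      push_cast
      ring_nf

/-! ### The two seed Bailey pairs -/

/-- One `M = 1` step applied to the unit Bailey pair, whose `β` is supported at `0`. -/
theorem invQPoch_one_eq_sum {n N : ℕ} (hn : n ≤ N) :
    invQPoch 1 n = ∑ j ∈ Finset.Icc (-1 - N : ℤ) N,
      altPow (quadExp 3 (3 - 2)) j * baileyKernel 1 1 n j := by
  have hq := two_mul_quadExp (A := 1) (B := -1) (by norm_num) (by norm_num)
  have hunit (s : ℕ) (hs : s ≤ N) : ∑ j ∈ Finset.Icc (-1 - N : ℤ) N,
      altPow (quadExp 1 (-1)) j * baileyKernel 1 1 s j = if s = 0 then 1 else 0 := by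
    rw [← sum_baileyKernel_zero_eq_one (fun j ↦ by
      have h2 := hq j
      have h3 := hq (-1 - j)
      linarith)]
    have h1 := hasSum_mul_baileyKernel 1 0 s N (by exact_mod_cast hs) (by omega)
      (altPow (quadExp 1 (-1)))
    -- Here `a = 0`, so the product contains `(1;q)_s`, which is zero for `s > 0`.
    have h2 := hasSum_finite_tripleProduct one_ne_zero (zero_add 1) (e := quadExp 1 (-1))
      (by simp [quadExp]) (fun j ↦ by
        have h2 := hq j
        have h3 := hq (j + 1)
        push_cast
        linarith) s s
    simp only [baileyKernel, Nat.cast_zero, add_zero] at h1 ⊢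
    rw [h1.unique h2]
    rcases s with _ | s
    · simp [qPoch]
    · simp [qPoch, Finset.prod_range_succ']
  have h1 := bailey_step le_rfl (Finset.Icc (-1 - N : ℤ) N) (altPow (quadExp 1 (-1))) n
  have h2 : ∑ j ∈ Finset.Icc (-1 - N : ℤ) N, altPow (quadExp 3 (3 - 2)) j *
      baileyKernel 1 1 n j = ∑ j ∈ Finset.Icc (-1 - N : ℤ) N, altPow (quadExp 1 (-1)) j *
        X ^ (j ^ 2 + (1 : ℕ) * j).toNat * baileyKernel 1 1 n j := by
    refine Finset.sum_congr rfl fun j _ ↦ ?_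
    rw [altPow_quadExp_mul le_rfl (by norm_num) (by norm_num)]
    norm_num
  rw [h2, ← h1, Finset.sum_eq_single 0]
  · rw [hunit 0 (Nat.zero_le N)]
    simp
  · intro s hs hs0
    rw [hunit s (by have := Finset.mem_range.mp hs; omega), if_neg hs0]
    simp
  · simp

/-- Induction by telescoping: with `F_n(j)` the summand, `(1 - q^{2n+2}) F_{n+1}(j) = F_n(j) + T j -
T (j+1)`. -/
theorem hasSum_bressoud_pair (n : ℕ) :
    HasSum (fun j ↦ altPow (quadExp 2 0) j * baileyKernel 1 0 n j) (invQPoch 2 n) := by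
  have hq (j : ℤ) : (quadExp 2 0 j : ℤ) = j ^ 2 := by
    have := two_mul_quadExp (A := 2) (B := 0) (by norm_num) (by norm_num) j
    linarith
  induction n with
  | zero =>
    convert hasSum_single (0 : ℤ) fun j hj ↦ ?_ using 1
    · simp [altPow, quadExp, baileyKernel]
    · rw [baileyKernel_eq_zero (by push_cast; omega), mul_zero]
  | succ n ih =>
    set T : ℤ → ℤ⟦X⟧ := fun j ↦ altPow (quadExp 2 0) j * X ^ (n + 1 - j).toNat *
      (invQPoch 1 (n + 1 - j) * invQPoch 1 (n + j)) with hT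
    have hTs : Summable T := by
      refine summable_of_ne_finset_zero (s := Finset.Icc (-n : ℤ) (n + 1)) fun j hj ↦ ?_
      rw [Finset.mem_Icc, not_and_or, not_le, not_le] at hj
      rcases hj with h | h
      · simp only [hT]
        rw [invQPoch_of_neg 1 (n := (n : ℤ) + j) (by omega)]; simp
      · simp only [hT]
        rw [invQPoch_of_neg 1 (n := (n : ℤ) + 1 - j) (by omega)]; simp
    have hu : IsUnit (1 - X ^ (2 * (n + 1)) : ℤ⟦X⟧) := by simp [isUnit_iff_constantCoeff]
    obtain ⟨v, hv⟩ := hu.exists_left_inv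
    have h2 := ((ih.add hTs.hasSum).sub
      ((Equiv.addRight (1 : ℤ)).hasSum_iff.mpr hTs.hasSum)).mul_left v
    convert h2 using 1
    · rfl
    · funext j
      have e1 := invQPoch_sub_one one_ne_zero (n + 1 - j : ℤ)
      have e2 := invQPoch_sub_one one_ne_zero (n + 1 + j : ℤ)
      simp only [Function.comp_apply, Equiv.coe_addRight, hT, baileyKernel, Nat.cast_zero,
        add_zero, Nat.cast_succ]
      rw [one_mul] at e1 e2
      rw [show (n + 1 - (j + 1) : ℤ) = n - j by ring, show (n + (j + 1) : ℤ) = n + 1 + j by ring,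
        show (n - j : ℤ) = n + 1 - j - 1 by ring, show (n + j : ℤ) = n + 1 + j - 1 by ring, e1, e2]
      by_cases hj : (n + 1 - j : ℤ) < 0 ∨ (n + 1 + j : ℤ) < 0
      · rcases hj with hj | hj <;> simp [invQPoch_of_neg 1 hj]
      · push Not at hj
        have h5 : (X : ℤ⟦X⟧) ^ (n + 1 - j).toNat * X ^ (n + 1 + j).toNat = X ^ (2 * (n + 1)) := by
          rw [← pow_add]
          congr 1
          omega
        have h3 : altPow (quadExp 2 0) (j + 1) * X ^ (n + 1 - j - 1).toNat *
            (1 - X ^ (n + 1 - j).toNat) =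
            - altPow (quadExp 2 0) j * X ^ (n + 1 + j).toNat * (1 - X ^ (n + 1 - j).toNat) := by
          -- At `j = n + 1` the exponent `n + 1 - j - 1` is truncated, but the factor `1 -
          -- q^{n+1-j}` is zero.
          rcases hj.1.eq_or_lt with h | h
          · rw [← h]; simp
          · congr 1
            rw [neg_mul, altPow_mul_X_pow, altPow_mul_X_pow, altPow, altPow,
              show quadExp 2 0 (j + 1) + (n + 1 - j - 1).toNat =
                quadExp 2 0 j + (n + 1 + j).toNat by
                zify
                rw [Int.toNat_of_nonneg hj.2, Int.toNat_of_nonneg (by omega), hq, hq]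
                ring]
            simp [Int.negOnePow_succ]
        set K := invQPoch 1 (n + 1 - j : ℤ) * invQPoch 1 (n + 1 + j : ℤ) with hK
        linear_combination v * altPow (quadExp 2 0) j * K * h5 -
          altPow (quadExp 2 0) j * K * hv + v * K * h3
    · have e1 := invQPoch_eq_mul_succ two_ne_zero n
      rw [e1, add_sub_cancel_right]
      linear_combination -(invQPoch 2 (n + 1 : ℕ)) * hv

theorem invQPoch_two_eq_sum {n N : ℕ} (hn : n ≤ N) :
    invQPoch 2 n = ∑ j ∈ Finset.Icc (-1 - N : ℤ) N,
      altPow (quadExp 2 (2 - 2)) j * baileyKernel 1 1 n j := by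
  have hq := two_mul_quadExp (A := 2) (B := 0) (by norm_num) (by norm_num)
  rw [sub_self, ← sum_baileyKernel_zero_eq_one (fun j ↦ by
    have h2 := hq j
    have h3 := hq (-1 - j)
    linarith)]
  exact (hasSum_bressoud_pair n).unique
    (hasSum_mul_baileyKernel 1 0 n N (by exact_mod_cast hn) (by omega) _)

/-! ### The multisum as a sum over partitions -/

/-- The summand of `nestedSum` attached to a partition. -/
noncomputable def nestedTerm (β : ℕ → ℤ⟦X⟧) : ℕ → ℕ → ℕ → (ℕ → ℕ) → ℤ⟦X⟧
  | 0, _, n, _ => β n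
  | k + 1, i, n, l => X ^ (l 0 ^ 2 + if i = 0 then l 0 else 0) *
      (invQPoch 1 (n - l 0 : ℤ) * nestedTerm β k (i - 1) (l 0) fun j ↦ l (j + 1))

theorem nestedTerm_eq_zero (β : ℕ → ℤ⟦X⟧) {k : ℕ} (i : ℕ) {n : ℕ} {l : ℕ → ℕ}
    (hl : l ∈ partitionsLE k) (h : n < l 0) : nestedTerm β k i n l = 0 := by
  rcases k with _ | k
  · have := hl.2 0 le_rfl
    omega
  · rw [nestedTerm, invQPoch_of_neg 1 (by omega), zero_mul, mul_zero]

theorem finite_partitionsLE_head_le (k n : ℕ) :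
    {l : partitionsLE k | (l : ℕ → ℕ) 0 ≤ n}.Finite := by
  have ht : (Set.univ.pi fun _ : Fin k ↦ Set.Iic n).Finite :=
    Set.Finite.pi fun _ ↦ Set.finite_Iic n
  refine Set.Finite.of_injOn (f := fun l (j : Fin k) ↦ l.1 j) ?_ ?_ ht
  · intro l hl j _
    exact (l.2.1 (Nat.zero_le j)).trans hl
  · intro l _ l' _ h
    ext j
    rcases lt_or_ge j k with hj | hj
    · exact congrFun h ⟨j, hj⟩
    · rw [l.2.2 j hj, l'.2.2 j hj]

/-- Splitting off the largest part. -/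
def partitionHeadTail (k : ℕ) (l : partitionsLE (k + 1)) : ℕ × partitionsLE k :=
  (l.1 0, ⟨fun j ↦ l.1 (j + 1), fun _ _ h ↦ l.2.1 (Nat.succ_le_succ h),
    fun j hj ↦ l.2.2 (j + 1) (Nat.succ_le_succ hj)⟩)

theorem partitionHeadTail_injective (k : ℕ) : Function.Injective (partitionHeadTail k) := by
  intro l l' h
  obtain ⟨h0, h1⟩ := Prod.ext_iff.mp h
  ext j
  rcases j with _ | j
  · exact h0
  · exact congrFun (congrArg Subtype.val h1) j

theorem mem_range_partitionHeadTail {k s : ℕ} {l : partitionsLE k} (h : l.1 0 ≤ s) :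
    (s, l) ∈ Set.range (partitionHeadTail k) := by
  refine ⟨⟨fun j ↦ Nat.casesOn j s l.1, antitone_nat_of_succ_le fun j ↦ ?_, fun j hj ↦ ?_⟩, rfl⟩
  · rcases j with _ | j
    · exact h
    · exact l.2.1 (Nat.le_succ j)
  · rcases j with _ | j
    · omega
    · exact l.2.2 j (by omega)

theorem hasSum_nestedTerm (β : ℕ → ℤ⟦X⟧) (k i n : ℕ) :
    HasSum (fun l : partitionsLE k ↦ nestedTerm β k i n l) (nestedSum β k i n) := by
  induction k generalizing i n with
  | zero =>
    have : Unique (partitionsLE 0) :=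
      { default := ⟨fun _ ↦ 0, fun _ _ _ ↦ le_rfl, fun _ _ ↦ rfl⟩
        uniq := fun l ↦ Subtype.ext (funext fun j ↦ l.2.2 j (Nat.zero_le j)) }
    exact hasSum_unique _
  | succ k ih =>
    -- All pairs (head, tail) are allowed: a tail whose first part exceeds the head contributes
    -- zero, as `1/(q)_n = 0` for `n < 0`.
    set f : ℕ × partitionsLE k → ℤ⟦X⟧ := fun x ↦ X ^ (x.1 ^ 2 + if i = 0 then x.1 else 0) *
      (invQPoch 1 (n - x.1 : ℤ) * nestedTerm β k (i - 1) x.1 x.2) with hf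
    have hsupp : Summable f := by
      refine summable_of_hasFiniteSupport
        (((Set.finite_Iic n).prod (finite_partitionsLE_head_le k n)).subset fun x hx ↦ ?_)
      have h1 : x.1 ≤ n := by
        by_contra h
        exact hx (by simp only [hf]; rw [invQPoch_of_neg 1 (by omega), zero_mul, mul_zero])
      have h2 : x.2.1 0 ≤ x.1 := by
        by_contra h
        exact hx (by simp only [hf]; rw [nestedTerm_eq_zero β _ x.2.2 (by omega)]; simp)
      exact ⟨h1, h2.trans h1⟩
    have h1 := hsupp.hasSum.prod_fiberwise
      fun s ↦ ((ih (i - 1) s).mul_left (invQPoch 1 (n - s : ℤ))).mul_left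
        (X ^ (s ^ 2 + if i = 0 then s else 0))
    have h2 : HasSum (fun s : ℕ ↦ X ^ (s ^ 2 + if i = 0 then s else 0) *
        (invQPoch 1 (n - s : ℤ) * nestedSum β k (i - 1) s)) (nestedSum β (k + 1) i n) := by
      refine hasSum_sum_of_ne_finset_zero fun s hs ↦ ?_
      rw [Finset.mem_range] at hs
      rw [invQPoch_of_neg 1 (by omega), zero_mul, mul_zero]
    have h3 := hsupp.hasSum
    rw [h1.unique h2, ← (partitionHeadTail_injective k).hasSum_iff] at h3
    · exact h3
    · intro x hx
      have : x.1 < x.2.1 0 := by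
        by_contra h
        exact hx (mem_range_partitionHeadTail (not_lt.mp h))
      simp only [hf]
      rw [nestedTerm_eq_zero β _ x.2.2 this]
      simp

theorem ringInverse_mul (a b : ℤ⟦X⟧) : Ring.inverse (a * b) = Ring.inverse a * Ring.inverse b := by
  rw [Ring.mul_inverse_rev, mul_comm]

theorem nestedTerm_eq_agbSummand (f k i n : ℕ) {l : ℕ → ℕ} (hl : l ∈ partitionsLE (k + 1)) :
    nestedTerm (fun n ↦ invQPoch f n) (k + 1) i n l =
      invQPoch 1 (n - l 0 : ℤ) * agbSummand f (k + 1) i l := by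
  induction k generalizing i n l with
  | zero =>
    rw [nestedTerm, nestedTerm, invQPoch_natCast f, agbSummand, agbExponent, agbDenominator]
    rcases i with _ | i
    · simp
      ring
    · simp
      ring
  | succ k ih =>
    have hl' : (fun j ↦ l (j + 1)) ∈ partitionsLE (k + 1) :=
      ⟨fun _ _ h ↦ hl.1 (Nat.succ_le_succ h), fun j hj ↦ hl.2 (j + 1) (Nat.succ_le_succ hj)⟩
    rw [nestedTerm, ih _ _ hl', agbSummand, agbSummand]
    have h1 : agbExponent (k + 1 + 1) i l = l 0 ^ 2 + (if i = 0 then l 0 else 0) +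
        agbExponent (k + 1) (i - 1) fun j ↦ l (j + 1) := by
      rw [agbExponent, agbExponent, Finset.sum_range_succ']
      rcases i with _ | i
      · rw [← Finset.range_eq_Ico, ← Finset.range_eq_Ico, Finset.sum_range_succ' l]
        simp only [if_true]
        ring
      · rw [Nat.add_sub_cancel, if_neg (Nat.succ_ne_zero i), ← Finset.sum_Ico_add' l]
        ring
    have h2 : agbDenominator f (k + 1 + 1) l = qPoch X X (l 0 - l 1) *
        agbDenominator f (k + 1) fun j ↦ l (j + 1) := by
      rw [agbDenominator, agbDenominator, Nat.add_sub_cancel, Nat.add_sub_cancel,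
        Finset.prod_range_succ']
      ring
    have h3 : Ring.inverse (qPoch (X : ℤ⟦X⟧) X (l 0 - l 1)) = invQPoch 1 (l 0 - l 1 : ℤ) := by
      have : l 1 ≤ l 0 := hl.1 (Nat.zero_le 1)
      rw [← Nat.cast_sub this, invQPoch_natCast, pow_one]
    rw [h1, h2, ringInverse_mul, h3, pow_add _ _ (agbExponent _ _ _), zero_add]
    ring

theorem X_pow_dvd_agbSummand (f k i : ℕ) (l : ℕ → ℕ) :
    X ^ l 0 ∣ agbSummand f (k + 1) i l := by
  refine Dvd.dvd.mul_right (pow_dvd_pow X ?_) _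
  rw [agbExponent, Finset.sum_range_succ']
  have := Nat.le_self_pow two_ne_zero (l 0)
  omega

/-! ### The limit of the chain and the conclusion -/

/-- The Andrews–Gordon–Bressoud identity for any `f` whose innermost factor `1 / (q^f; q^f)_n`
belongs to the Bailey pair with exponents `(A j^2 + (A - 2) j) / 2`. -/
theorem hasSum_agbSummand {f p : ℕ} {A : ℤ} (hA : 1 ≤ A)
    (hf : ∀ n N : ℕ, n ≤ N → invQPoch f n = ∑ j ∈ Finset.Icc (-1 - N : ℤ) N,
      altPow (quadExp A (A - 2)) j * baileyKernel 1 1 n j)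
    (r i : ℕ) (hk : r + i ≠ 0) (hp : (p : ℤ) = A + 2 * (r + i)) :
    HasSum (fun l : partitionsLE (r + i) ↦ agbSummand f (r + i) i l) (agbProduct p i) := by
  obtain ⟨k, hk⟩ := Nat.exists_eq_succ_of_ne_zero hk
  have hq := two_mul_quadExp (A := p) (B := A - 2 + 2 * r)
    (by rw [abs_le]; constructor <;> linarith) (by rw [hp]; exact ⟨A - 1 + 2 * r + i, by ring⟩)
  have hle (j : ℤ) : j.natAbs ≤ quadExp p (A - 2 + 2 * r) j := by
    -- The choice `c = 2` is possible since `p - (A - 2 + 2r) = 2i + 2`; halving gives the bound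
    -- `|j|`.
    have h1 := natAbs_mul_le_quadratic (A := p) (B := A - 2 + 2 * r) (c := 2)
      (by rw [abs_le]; constructor <;> linarith) (by norm_num) j
    have h2 := hq j
    omega
  have hJ := tsum_altPow_eq_qPochInf (p := p) (a := p - i - 1) (b := i + 1) (by omega) (by omega)
    (by omega) (e := quadExp p (A - 2 + 2 * r)) (by simp [quadExp]) (fun j ↦ by
      have h1 := hq j
      have h2 := hq (j + 1)
      rw [show ((p - i - 1 : ℕ) : ℤ) = p - i - 1 by omega]
      linarith) hle
  have hdvd (l : partitionsLE (r + i)) : X ^ l.1 0 ∣ agbSummand f (r + i) i l := by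
    obtain ⟨l, -⟩ := l
    simp only [hk]
    exact X_pow_dvd_agbSummand f k i l
  have hs : Summable fun l : partitionsLE (r + i) ↦ agbSummand f (r + i) i l :=
    summable_of_X_pow_dvd (fun l ↦ l.1 0) (finite_partitionsLE_head_le (r + i)) hdvd
  have hmod (n : ℕ) : X ^ (n + 1) ∣ qPochInf X X *
      (∑' l : partitionsLE (r + i), agbSummand f (r + i) i l) -
        ∑' j, altPow (quadExp p (A - 2 + 2 * r)) j := by
    have h1 := X_pow_dvd_bailey_sub_tsum one_ne_zero (fun j ↦ X_pow_dvd_altPow (hle j)) n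
    have h2 := nestedSum_eq hA (N := n) (fun m hm ↦ hf m n hm) r i n le_rfl
    rw [← hp] at h2
    rw [← h2, pow_one] at h1
    have h3 : X ^ (n + 1) ∣ qPochInf X X * nestedSum (fun n ↦ invQPoch f n) (r + i) i n -
        ∑' l : partitionsLE (r + i), agbSummand f (r + i) i l := by
      refine X_pow_dvd_of_hasSum (((hasSum_nestedTerm _ _ _ _).mul_left _).sub hs.hasSum)
        fun l ↦ ?_
      have h4 : nestedTerm (fun n ↦ invQPoch f n) (r + i) i n l =
          invQPoch 1 (n - l.1 0 : ℤ) * agbSummand f (r + i) i l := by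
        obtain ⟨l, hl⟩ := l
        rw [hk] at hl
        simp only [hk]
        exact nestedTerm_eq_agbSummand f k i n hl
      rw [h4, ← mul_assoc]
      -- The summand supplies `q^{l 0}` and `(q)_∞/(q)_{n-l 0} - 1` supplies `q^{n-l 0+1}`; for `l 0
      -- > n` the summand alone suffices.
      rcases le_or_gt (l.1 0) n with h | h
      · have h5 := mul_dvd_mul (X_pow_dvd_qPochInf_mul_invQPoch_sub_one one_ne_zero (n - l.1 0))
          (hdvd l)
        rw [← pow_add, show n - l.1 0 + 1 + l.1 0 = n + 1 by omega, pow_one, sub_mul, one_mul,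
          Nat.cast_sub h] at h5
        exact h5
      · have h5 := (pow_dvd_pow X h).trans (hdvd l)
        exact dvd_sub (h5.mul_left _) h5
    convert dvd_sub h1 (h3.mul_left (qPochInf X X)) using 1
    ring
  have heq := eq_of_forall_X_pow_dvd_sub hmod
  convert hs.hasSum using 1
  rw [agbProduct, mul_comm (qPochInf (X ^ (i + 1)) _), ← hJ, ← heq, mul_right_comm,
    Ring.mul_inverse_cancel _ isUnit_qPochInf_X, one_mul]

theorem mainTheorem3 (d i : ℕ) (hd : 2 ≤ d) (hi : i ≤ d / 2) :
    (Odd d →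
      HasSum (fun l : partitionsLE (d / 2) ↦ agbSummand 1 (d / 2) i l) (agbProduct (d + 2) i)) ∧
    (Even d →
      HasSum (fun l : partitionsLE (d / 2) ↦ agbSummand 2 (d / 2) i l) (agbProduct (d + 2) i)) := by
  obtain ⟨r, hr⟩ := Nat.exists_eq_add_of_le' hi
  rw [hr]
  constructor
  · rintro ⟨m, rfl⟩
    exact hasSum_agbSummand (A := 3) (by norm_num) (fun n N ↦ invQPoch_one_eq_sum) r i (by omega)
      (by omega)
  · rintro ⟨m, rfl⟩
    exact hasSum_agbSummand (A := 2) (by norm_num) (fun n N ↦ invQPoch_two_eq_sum) r i (by omega)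
      (by omega)
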